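/- Let $n,p\ge 0$ be integers and let $a,c$ be real numbers with $c>0$. Let $E_{\nu\mu}$ ($0\le\nu,\mu\le n$) be the matrix units of size $n+1$; put $Z_{\nu\mu}=E_{\nu\mu}-E_{\mu\nu}$, $T_{\nu\mu}=E_{\nu\mu}+E_{\mu\nu}$, $X^1=\tfrac12 iT_{00}$, and $Y^1_{2\nu-1}=Z_{\nu0}$, $Y^1_{2\nu}=iT_{\nu0}$ for $1\le\nu\le n$, all in $\mathfrak u(n+1)$; define $X^2$, $Y^2_{2\mu-1}$, $Y^2_{2\mu}$ ($1\le\mu\le p$) in $\mathfrak u(p+1)$ in the same way. These vectors span a subspace $\mathfrak p\subset\mathfrak u(n+1)\times\mathfrak u(p+1)$, identified (by $X\mapsto\frac{d}{dt}|_{t=0}\exp(tX)\,o$) with the tangent space at the base point $o$ of $S^{2n+1}\times S^{2p+1}=U(n+1)/U(n)\times U(p+1)/U(p)$. Let $g(a,c)$ be the $U(n+1)\times U(p+1)$-invariant Riemannian metric on $S^{2n+1}\times S^{2p+1}$ given by $g(a,c)(X,Y)=\omega(X,I(a,c)Y)$, where $\omega$ and $I(a,c)$ are the invariant $2$-form and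 the invariant almost complex structure given at $o$ by $$\omega=X^1\wedge X^2+\sum_{\nu=1}^nY^1_{2\nu-1}\wedge Y^1_{2\nu}+\sum_{\nu=1}^pY^2_{2\nu-1}\wedge Y^2_{2\nu}$$ (here the symbols denote the dual basis) and $$I(a,c)X^1=\tfrac ac X^1+\tfrac1c X^2,\quad I(a,c)X^2=-\tfrac{a^2+c^2}{c}X^1-\tfrac ac X^2,\quad I(a,c)Y^1_{2\nu-1}=Y^1_{2\nu},\quad I(a,c)Y^2_{2\mu-1}=Y^2_{2\mu}.$$ Let $$Z_0=\sqrt c\,X^1,\quad Z_k=Y^1_k\ (1\le k\le 2n),\quad Z_{2n+1}=\tfrac{a}{\sqrt c}X^1+\tfrac1{\sqrt c}X^2,\quad Z_{2n+1+k}=Y^2_k\ (1\le k\le 2p),$$ which is an orthonormal basis of $\mathfrak p$ for $g(a,c)$, and let $R_{(\alpha\nu)(\rho\mu)}=g(a,c)\bigl(R(Z_\alpha,Z_\nu)Z_\mu,Z_\rho\bigr)$, where $R(X,Y)=[\nabla_X,\nabla_Y]-\nabla_{[X,Y]}$ is the curvature tensor at $o$ of the Levi-Civita connection $\nabla$ of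 $g(a,c)$. Then for all $1\le l\le n$ and $1\le m\le p$ $$R_{(2l-1,\,2n+2m)(2l,\,2n+2m+1)}=\frac ac,\qquad R_{(2l,\,2n+2m)(2l-1,\,2n+2m+1)}=-\frac ac,$$ $$R_{(2l-1,\,2n+2m+1)(2l,\,2n+2m)}=-\frac ac,\qquad R_{(2l,\,2n+2m+1)(2l-1,\,2n+2m)}=\frac ac,$$ and $R_{(\alpha\nu)(\rho\mu)}=0$ for all other values of $\alpha,\rho\in\{1,\dots,2n\}$ and $\nu,\mu\in\{2n+2,\dots,2n+2p+1\}$. -/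

import Mathlib

open Metric Module
open scoped Manifold ContDiff

noncomputable section

namespace HermitianSpheres

/-! ### Riemannian curvature of a metric in coordinates -/

section Coordinates

variable {E : Type*} [NormedAddCommGroup E] [NormedSpace ℝ E]

/-- The Christoffel symbol `Γ_x(u, v)` of a metric `h` on (an open subset of) a finite-dimensional
vector space `E`: the vector determined by
`2 h_x(Γ_x(u, v), w) = ∂_u h(v, w) + ∂_v h(u, w) - ∂_w h(u, v)` for all `w`. -/
def christoffel (h : E → E →L[ℝ] E →L[ℝ] ℝ) (x u v : E) : E :=
  (h x).inverse ((1 / 2 : ℝ) •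
    (fderiv ℝ h x u v + fderiv ℝ h x v u - ((fderiv ℝ h x).flip u).flip v))

/-- The curvature `R_x(u, v) w = ∇_u ∇_v w - ∇_v ∇_u w` (for constant, hence commuting, vector
fields `u`, `v`, `w`) of the Levi-Civita connection `∇ = ∂ + Γ` of a metric `h` on (an open subset
of) `E`. -/
def curvatureInCoordinates (h : E → E →L[ℝ] E →L[ℝ] ℝ) (x u v w : E) : E :=
  fderiv ℝ (fun y => christoffel h y v w) x u - fderiv ℝ (fun y => christoffel h y u w) x v
    + christoffel h x u (christoffel h x v w) - christoffel h x v (christoffel h x u w)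

end Coordinates

section Manifold

variable {E : Type*} [NormedAddCommGroup E] [NormedSpace ℝ E]
  {H : Type*} [TopologicalSpace H] (I : ModelWithCorners ℝ E H) [I.Boundaryless]
  {M : Type*} [TopologicalSpace M] [ChartedSpace H M]

/-- The coordinate expression of a metric `g` on the manifold `M` in the chart around `q`: the
pull-back of `g` under the inverse of the chart. -/
def metricInChart (g : ∀ q : M, TangentSpace I q →L[ℝ] TangentSpace I q →L[ℝ] ℝ) (q : M) (x : E) :
    E →L[ℝ] E →L[ℝ] ℝ :=
  let d : E →L[ℝ] TangentSpace I ((extChartAt I q).symm x) :=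
    mfderiv 𝓘(ℝ, E) I (extChartAt I q).symm x
  (ContinuousLinearMap.precomp ℝ d).comp ((g ((extChartAt I q).symm x)).comp d)

/-- The curvature tensor `R(u, v) w = ∇_u ∇_v w - ∇_v ∇_u w - ∇_{[u, v]} w` at the point `q` of the
Levi-Civita connection of the metric `g` on a manifold without boundary, computed in the chart
around `q`. -/
def curvature (g : ∀ q : M, TangentSpace I q →L[ℝ] TangentSpace I q →L[ℝ] ℝ) (q : M)
    (u v w : TangentSpace I q) : TangentSpace I q :=
  let d : TangentSpace I q →L[ℝ] E := mvfderiv I (extChartAt I q) q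
  d.inverse
    (curvatureInCoordinates (metricInChart I g q) (extChartAt I q q) (d u) (d v) (d w))

end Manifold

/-! ### The product of spheres `S^{2n+1} × S^{2p+1}` -/

/-- The space `ℂ^{n+1}` with its Hermitian norm. -/
abbrev CVec (n : ℕ) : Type := EuclideanSpace ℂ (Fin (n + 1))

instance finrank_cVec (n : ℕ) : Fact (finrank ℝ (CVec n) = 2 * n + 1 + 1) :=
  ⟨by rw [← finrank_mul_finrank ℝ ℂ, finrank_euclideanSpace_fin, Complex.finrank_real_complex]
      ring⟩

/-- The space `ℂ^{n+1} × ℂ^{p+1}`. -/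
abbrev Ambient (n p : ℕ) : Type := CVec n × CVec p

/-- The smooth manifold `S^{2n+1} × S^{2p+1} ⊆ ℂ^{n+1} × ℂ^{p+1}`, the homogeneous space
`U(n+1)/U(n) × U(p+1)/U(p)`. -/
abbrev SphereProd (n p : ℕ) : Type := sphere (0 : CVec n) 1 × sphere (0 : CVec p) 1

/-- The model of `S^{2n+1} × S^{2p+1}`. -/
abbrev sphereModel (n p : ℕ) :
    ModelWithCorners ℝ (EuclideanSpace ℝ (Fin (2 * n + 1)) × EuclideanSpace ℝ (Fin (2 * p + 1)))
      (ModelProd (EuclideanSpace ℝ (Fin (2 * n + 1))) (EuclideanSpace ℝ (Fin (2 * p + 1)))) :=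
  (𝓡 (2 * n + 1)).prod (𝓡 (2 * p + 1))

/-- The inclusion of `S^{2n+1} × S^{2p+1}` in `ℂ^{n+1} × ℂ^{p+1}`. -/
def incl {n p : ℕ} (q : SphereProd n p) : Ambient n p := (q.1, q.2)

/-- The (injective) differential of the inclusion. -/
def dIncl {n p : ℕ} (q : SphereProd n p) :
    TangentSpace (sphereModel n p) q →L[ℝ] Ambient n p :=
  mvfderiv (sphereModel n p) (incl (n := n) (p := p)) q

/-! ### The invariant tensors `ω`, `I(a, c)` and `g(a, c)`

The fields of tensors are `U(n+1) × U(p+1)`-invariant. A tangent vector of `S^{2n+1} × S^{2p+1}` at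
`(z, w)` is the sum of multiples of the vectors `(i z, 0)` and `(0, i w)`, which are tangent to the
Hopf circles (at the base point these are `X^1` and `X^2`), and of a horizontal part, orthogonal
to the complex lines of `z` and `w`, on which the complex structure is the multiplication
by `i`. -/

/-- The coordinate of the tangent vector `u` along `i z`. -/
def hopfCoord {n : ℕ} (z u : CVec n) : ℝ := inner ℝ (Complex.I • z) u

/-- The horizontal part of the tangent vector `u` of the sphere at `z`. -/
def horPart {n : ℕ} (z u : CVec n) : CVec n := u - hopfCoord z u • Complex.I • z

/-- The 2-form `ω = X^1 ∧ X^2 + ∑ Y^1_{2ν-1} ∧ Y^1_{2ν} + ∑ Y^2_{2ν-1} ∧ Y^2_{2ν}` at `q`, where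
`(α ∧ β)(u, v) = α(u) β(v) - α(v) β(u)`. The two sums are the forms `(u, v) ↦ Re ⟨i u, v⟩` on
horizontal vectors. -/
def omega {n p : ℕ} (q ξ ζ : Ambient n p) : ℝ :=
  hopfCoord q.1 ξ.1 * hopfCoord q.2 ζ.2 - hopfCoord q.1 ζ.1 * hopfCoord q.2 ξ.2
    + inner ℝ (Complex.I • horPart q.1 ξ.1) (horPart q.1 ζ.1)
    + inner ℝ (Complex.I • horPart q.2 ξ.2) (horPart q.2 ζ.2)

/-- The almost complex structure `I(a, c)` on the tangent space at `q`:
`I X^1 = (a/c) X^1 + (1/c) X^2`, `I X^2 = -((a²+c²)/c) X^1 - (a/c) X^2`, and `I` is the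
multiplication by `i` on horizontal vectors (`I Y_{2ν-1} = Y_{2ν}`). -/
def cpxStructure {n p : ℕ} (a c : ℝ) (q ξ : Ambient n p) : Ambient n p :=
  (Complex.I • horPart q.1 ξ.1
      + (a / c * hopfCoord q.1 ξ.1 - (a ^ 2 + c ^ 2) / c * hopfCoord q.2 ξ.2) • Complex.I • q.1,
    Complex.I • horPart q.2 ξ.2
      + (1 / c * hopfCoord q.1 ξ.1 - a / c * hopfCoord q.2 ξ.2) • Complex.I • q.2)

lemma inner_map_cVec {n : ℕ} (A : CVec n ≃ₗᵢ[ℂ] CVec n) (u v : CVec n) :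
    inner ℝ (A u) (A v) = inner ℝ u v :=
  LinearIsometry.inner_map_map
    ({ toLinearMap := A.toLinearEquiv.toLinearMap.restrictScalars ℝ
       norm_map' := A.norm_map } : CVec n →ₗᵢ[ℝ] CVec n) u v

lemma hopfCoord_map {n : ℕ} (A : CVec n ≃ₗᵢ[ℂ] CVec n) (z u : CVec n) :
    hopfCoord (A z) (A u) = hopfCoord z u := by
  unfold hopfCoord
  rw [← map_smul, inner_map_cVec]

lemma horPart_map {n : ℕ} (A : CVec n ≃ₗᵢ[ℂ] CVec n) (z u : CVec n) :
    horPart (A z) (A u) = A (horPart z u) := by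
  simp [horPart, hopfCoord_map, ← Complex.coe_smul]

/-- The 2-form `ω` is `U(n+1) × U(p+1)`-invariant. -/
lemma omega_map {n p : ℕ} (A : CVec n ≃ₗᵢ[ℂ] CVec n) (B : CVec p ≃ₗᵢ[ℂ] CVec p)
    (q ξ ζ : Ambient n p) :
    omega (A q.1, B q.2) (A ξ.1, B ξ.2) (A ζ.1, B ζ.2) = omega q ξ ζ := by
  simp only [omega, hopfCoord_map, horPart_map, ← map_smul, inner_map_cVec]

/-- The almost complex structure `I(a, c)` is `U(n+1) × U(p+1)`-invariant. -/
lemma cpxStructure_map {n p : ℕ} (a c : ℝ) (A : CVec n ≃ₗᵢ[ℂ] CVec n)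
    (B : CVec p ≃ₗᵢ[ℂ] CVec p) (q ξ : Ambient n p) :
    cpxStructure a c (A q.1, B q.2) (A ξ.1, B ξ.2) =
      (A (cpxStructure a c q ξ).1, B (cpxStructure a c q ξ).2) := by
  simp only [cpxStructure, hopfCoord_map, horPart_map, ← Complex.coe_smul, map_add, map_smul]

/-- The bilinear form `(ξ, ζ) ↦ ω(ξ, I(a, c) ζ)` at the point `q`. -/
def metricForm {n p : ℕ} (a c : ℝ) (q : Ambient n p) :
    Ambient n p →L[ℝ] Ambient n p →L[ℝ] ℝ :=
  LinearMap.toContinuousBilinearMap <| LinearMap.mk₂ ℝ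
    (fun ξ ζ => omega q ξ (cpxStructure a c q ζ))
    (by
      intro ξ ξ' ζ
      simp only [omega, horPart, hopfCoord, Prod.fst_add, Prod.snd_add, inner_add_left,
        inner_add_right, inner_sub_left, inner_sub_right, smul_sub, smul_add, add_smul]
      ring)
    (by
      intro r ξ ζ
      simp only [omega, horPart, hopfCoord, Prod.smul_fst, Prod.smul_snd, inner_sub_left,
        inner_sub_right, smul_sub, smul_comm Complex.I r, inner_smul_right,
        real_inner_smul_left, smul_eq_mul, mul_smul]
      ring)
    (by
      intro ξ ζ ζ'
      simp only [omega, cpxStructure, horPart, hopfCoord, Prod.fst_add, Prod.snd_add,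
        inner_add_right, inner_sub_left, inner_sub_right, smul_sub, smul_add, add_smul,
        real_inner_smul_right]
      ring)
    (by
      intro r ξ ζ
      simp only [omega, cpxStructure, horPart, hopfCoord, Prod.smul_fst, Prod.smul_snd,
        inner_sub_left, inner_sub_right, inner_add_right, smul_sub, smul_comm Complex.I r,
        real_inner_smul_right, smul_eq_mul, mul_smul]
      ring)

/-- The metric `g(a, c)(u, v) = ω(u, I(a, c) v)` on `S^{2n+1} × S^{2p+1}`. -/
def metric (n p : ℕ) (a c : ℝ) (q : SphereProd n p) :
    TangentSpace (sphereModel n p) q →L[ℝ] TangentSpace (sphereModel n p) q →L[ℝ] ℝ :=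
  (ContinuousLinearMap.precomp ℝ (dIncl q)).comp ((metricForm a c (incl q)).comp (dIncl q))

/-! ### The orthonormal basis of `𝔭` and the components of the curvature -/

/-- The vector `e_0` of `ℂ^{n+1}`. -/
def baseVec (n : ℕ) : CVec n := EuclideanSpace.single 0 1

/-- The base point `o = (e_0, e_0)`, whose stabilizer in `U(n+1) × U(p+1)` is `U(n) × U(p)`. -/
def basePoint (n p : ℕ) : SphereProd n p :=
  (⟨baseVec n, by simp [baseVec]⟩, ⟨baseVec p, by simp [baseVec]⟩)

/-- The matrix with entry `1` at the place `(ν, μ)` and `0` elsewhere, `0 ≤ ν, μ ≤ n`. -/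
def matE (n ν μ : ℕ) : Matrix (Fin (n + 1)) (Fin (n + 1)) ℂ :=
  Matrix.of fun i j => if (i : ℕ) = ν ∧ (j : ℕ) = μ then 1 else 0

/-- `Z_{νμ} = E_{νμ} - E_{μν}`. -/
def matZ (n ν μ : ℕ) : Matrix (Fin (n + 1)) (Fin (n + 1)) ℂ := matE n ν μ - matE n μ ν

/-- `T_{νμ} = E_{νμ} + E_{μν}`. -/
def matT (n ν μ : ℕ) : Matrix (Fin (n + 1)) (Fin (n + 1)) ℂ := matE n ν μ + matE n μ ν

/-- `X = (1/2) i T_{00}`. -/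
def matX (n : ℕ) : Matrix (Fin (n + 1)) (Fin (n + 1)) ℂ := (1 / 2 * Complex.I) • matT n 0 0

/-- `Y_{2ν-1} = Z_{ν0}` and `Y_{2ν} = i T_{ν0}`, for `1 ≤ ν ≤ n`. -/
def matY (n k : ℕ) : Matrix (Fin (n + 1)) (Fin (n + 1)) ℂ :=
  if Even k then Complex.I • matT n (k / 2) 0 else matZ n ((k + 1) / 2) 0

/-- The basis `Z_0, …, Z_{2n+2p+1}` of `𝔭 ⊆ 𝔲(n+1) × 𝔲(p+1)`, orthonormal for `g(a, c)`:
`Z_0 = √c X^1`, `Z_k = Y^1_k` for `1 ≤ k ≤ 2n`, `Z_{2n+1} = (a/√c) X^1 + (1/√c) X^2`, and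
`Z_{2n+1+k} = Y^2_k` for `1 ≤ k ≤ 2p`. -/
def basisP (n p : ℕ) (a c : ℝ) (k : ℕ) :
    Matrix (Fin (n + 1)) (Fin (n + 1)) ℂ × Matrix (Fin (p + 1)) (Fin (p + 1)) ℂ :=
  if k = 0 then (√c • matX n, 0)
  else if k ≤ 2 * n then (matY n k, 0)
  else if k = 2 * n + 1 then ((a / √c) • matX n, (1 / √c) • matX p)
  else (0, matY p (k - (2 * n + 1)))

/-- The velocity at `t = 0` of the curve `t ↦ exp(tX) o`, as a vector of the ambient space. -/
def orbitVelocity {n p : ℕ}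
    (X : Matrix (Fin (n + 1)) (Fin (n + 1)) ℂ × Matrix (Fin (p + 1)) (Fin (p + 1)) ℂ) :
    Ambient n p :=
  (Matrix.toEuclideanLin X.1 (baseVec n), Matrix.toEuclideanLin X.2 (baseVec p))

/-- The tangent vector at the base point that corresponds to `Z_k` under the identification of `𝔭`
with the tangent space: the (unique) one that the inclusion maps to the velocity of
`t ↦ exp(t Z_k) o`. -/
def frame (n p : ℕ) (a c : ℝ) (k : ℕ) :
    TangentSpace (sphereModel n p) (basePoint n p) :=
  Function.invFun (dIncl (basePoint n p)) (orbitVelocity (basisP n p a c k))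

lemma dIncl_apply {n p : ℕ} (q : SphereProd n p) (u : TangentSpace (sphereModel n p) q) :
    dIncl q u = (mvfderiv (𝓡 (2 * n + 1)) ((↑) : sphere (0 : CVec n) 1 → CVec n) q.1 u.1,
      mvfderiv (𝓡 (2 * p + 1)) ((↑) : sphere (0 : CVec p) 1 → CVec p) q.2 u.2) := by
  have h1 : MDifferentiableAt (𝓡 (2 * n + 1)) 𝓘(ℝ, CVec n) ((↑) : sphere (0 : CVec n) 1 → CVec n) q.1 :=
    (contMDiff_coe_sphere (m := 1)).mdifferentiable (by simp) _
  have h2 : MDifferentiableAt (𝓡 (2 * p + 1)) 𝓘(ℝ, CVec p) ((↑) : sphere (0 : CVec p) 1 → CVec p) q.2 :=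
    (contMDiff_coe_sphere (m := 1)).mdifferentiable (by simp) _
  have ha := h1.hasMFDerivAt.comp (I := sphereModel n p) q (hasMFDerivAt_fst q)
  have hb := h2.hasMFDerivAt.comp (I := sphereModel n p) q (hasMFDerivAt_snd q)
  have h : HasMFDerivAt (sphereModel n p) 𝓘(ℝ, Ambient n p) (incl (n := n) (p := p)) q
      (ContinuousLinearMap.prod (M₁ := TangentSpace (sphereModel n p) q) (M₂ := CVec n)
        (M₃ := CVec p) _ _) :=
    ⟨ha.1.prodMk hb.1, ha.2.prodMk hb.2⟩
  unfold dIncl mvfderiv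
  exact congrArg (fun L => L u) h.mfderiv

lemma mem_range_mvfderiv {n : ℕ} (z : sphere (0 : CVec n) 1) (v : CVec n)
    (h : inner ℝ (z : CVec n) v = 0) :
    ∃ u, mvfderiv (𝓡 (2 * n + 1)) ((↑) : sphere (0 : CVec n) 1 → CVec n) z u = v := by
  have := range_mvfderiv_subtypeVal (n := 2 * n + 1) z
  have h2 : v ∈ (ℝ ∙ (z : CVec n))ᗮ := by rwa [Submodule.mem_orthogonal_singleton_iff_inner_right]
  rw [← this] at h2
  exact h2

lemma orbit_ortho1 (n p : ℕ) (a c : ℝ) (k : ℕ) :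
    inner ℝ (baseVec n) (orbitVelocity (basisP n p a c k)).1 = 0 := by
  simp only [baseVec, orbitVelocity, basisP, PiLp.inner_apply, Matrix.toLpLin_apply, Complex.inner]
  rw [Finset.sum_eq_single 0]
  · split_ifs <;> simp [matX, matY, matT, matZ, matE]
    split_ifs <;> simp <;> aesop
  · intro b _ hb; simp [Ne.symm hb]
  · simp

lemma orbit_ortho2 (n p : ℕ) (a c : ℝ) (k : ℕ) :
    inner ℝ (baseVec p) (orbitVelocity (basisP n p a c k)).2 = 0 := by
  simp only [baseVec, orbitVelocity, basisP, PiLp.inner_apply, Matrix.toLpLin_apply, Complex.inner]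
  rw [Finset.sum_eq_single 0]
  · split_ifs <;> simp [matX, matY, matT, matZ, matE]
    split_ifs <;> simp <;> aesop
  · intro b _ hb; simp [Ne.symm hb]
  · simp

/-- The vector `frame n p a c k` is well defined: the inclusion maps it to the velocity of
`t ↦ exp(t Z_k) o`. -/
lemma dIncl_frame (n p : ℕ) (a c : ℝ) (k : ℕ) :
    dIncl (basePoint n p) (frame n p a c k) = orbitVelocity (basisP n p a c k) := by
  unfold frame
  apply Function.invFun_eq
  obtain ⟨u, hu⟩ := mem_range_mvfderiv (basePoint n p).1 _ (orbit_ortho1 n p a c k)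
  obtain ⟨v, hv⟩ := mem_range_mvfderiv (basePoint n p).2 _ (orbit_ortho2 n p a c k)
  exact ⟨((u, v) : _ × _), (dIncl_apply (basePoint n p) ((u, v) : _ × _)).trans (Prod.ext hu hv)⟩

/-- The components `R_{(αν)(ρμ)} = ⟨R(Z_α, Z_ν) Z_μ, Z_ρ⟩` of the curvature tensor of `g(a, c)`. -/
def curvatureComponent (n p : ℕ) (a c : ℝ) (α ν ρ μ : ℕ) : ℝ :=
  metric n p a c (basePoint n p)
    (curvature (sphereModel n p) (metric n p a c) (basePoint n p)
      (frame n p a c α) (frame n p a c ν) (frame n p a c μ))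
    (frame n p a c ρ)

end HermitianSpheres

end

/-! The two spheres interact only through the Hopf directions. With `η₁`, `η₂` the Hopf 1-forms dual
to `X^1`, `X^2`, formula `metricForm_apply` gives `g(a,c) = k₁ + k₂ - (a/c)(η₁ ⊗ η₂ + η₂ ⊗ η₁)`,
where `kᵢ` is the round metric of the `i`-th sphere plus a multiple of `ηᵢ²`. In product coordinates
this is the structure `IsTwistedProduct`, with `B = -a/c`.

Take stereographic coordinates centred at the point, vectors `u`, `t` on the first factor and `v`,
`w` on the second, with `u`, `v`, `w` horizontal. There the round metric has zero first derivatives,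
and `∂_u η(t) = ⟨i u, t⟩` is antisymmetric in `u`, `t`. Hence `Γ(v, w)` and `Γ(u, w)` vanish at the
point. The quadratic terms of the curvature drop out, and so do the derivatives of the inverse
metric. What remains is half a difference of derivatives of Koszul expressions
(`apply_curvatureInCoordinates`), which equals `-B ∂_u η₁(t) ∂_v η₂(w)`
(`IsTwistedProduct.apply_curvature`).

Thus `g(R(u,v)w, t) = (a/c) ⟨i u, t⟩ ⟨i v, w⟩` (`metric_curvature`). On the horizontal frame `e_l, i
e_l` the pairing `⟨i ·, ·⟩` is the standard symplectic form, so a product of two such pairings is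
nonzero exactly on the four listed families, with the stated signs. -/

noncomputable section

namespace HermitianSpheres

/-! ### Curvature from Koszul expressions where Christoffel symbols vanish. -/

section Koszul

variable {E : Type*} [NormedAddCommGroup E] [NormedSpace ℝ E]

/-- The Koszul expression `2 h_y(Γ_y(v, w), t)` of a metric `h` in coordinates. -/
def koszul (h : E → E →L[ℝ] E →L[ℝ] ℝ) (y v w t : E) : ℝ :=
  fderiv ℝ (fun z => h z w t) y v + fderiv ℝ (fun z => h z v t) y w
    - fderiv ℝ (fun z => h z v w) y t

lemma fderiv_apply_apply {h : E → E →L[ℝ] E →L[ℝ] ℝ} {y : E} (hd : DifferentiableAt ℝ h y)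
    (w t v : E) : fderiv ℝ (fun z => h z w t) y v = fderiv ℝ h y v w t := by
  have := (hd.hasFDerivAt.clm_apply (hasFDerivAt_const w y)).clm_apply (hasFDerivAt_const t y)
  rw [this.fderiv]
  simp

/-- The functional `2 h_y(Γ_y(v, w), ·)`. -/
def koszulCLM (h : E → E →L[ℝ] E →L[ℝ] ℝ) (y v w : E) : E →L[ℝ] ℝ :=
  fderiv ℝ h y v w + fderiv ℝ h y w v - ((fderiv ℝ h y).flip v).flip w

lemma koszul_eq {h : E → E →L[ℝ] E →L[ℝ] ℝ} {y : E} (hd : DifferentiableAt ℝ h y) (v w t : E) :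
    koszul h y v w t = koszulCLM h y v w t := by
  simp [koszul, koszulCLM, fderiv_apply_apply hd]

lemma differentiable_koszulCLM [FiniteDimensional ℝ E] {h : E → E →L[ℝ] E →L[ℝ] ℝ}
    (hh : ContDiff ℝ 2 h) (v w : E) : Differentiable ℝ (fun y => koszulCLM h y v w) := by
  have h3 (a b t : E) : ContDiff ℝ 1 (fun y => fderiv ℝ (fun z => h z b t) y a) :=
    (((hh.clm_apply contDiff_const).clm_apply contDiff_const).fderiv_right (m := 1)
      (by norm_num)).clm_apply contDiff_const
  refine ContDiff.differentiable (n := 1) (contDiff_clm_apply_iff.2 fun t => ?_) (by norm_num)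
  simp only [← koszul_eq (hh.differentiable (by norm_num) _)]
  exact ((h3 v w t).add (h3 w v t)).sub (h3 t v w)

/-- The Christoffel symbol is the inverse metric applied to half the Koszul functional. Since that
functional is zero at `x`, the product rule leaves no term with the derivative of the inverse. -/
lemma apply_fderiv_christoffel [FiniteDimensional ℝ E] {h : E → E →L[ℝ] E →L[ℝ] ℝ}
    (hh : ContDiff ℝ 2 h) {x : E} (hi : (h x).IsInvertible) {v w : E}
    (h0 : ∀ s, koszul h x v w s = 0) (u t : E) :
    h x (fderiv ℝ (fun y => christoffel h y v w) x u) t =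
      1 / 2 * fderiv ℝ (fun y => koszul h y v w t) x u := by
  have hd : Differentiable ℝ h := hh.differentiable (by norm_num)
  have hk := differentiable_koszulCLM hh v w
  have hk0 : koszulCLM h x v w = 0 := by
    ext s
    rw [← koszul_eq (hd x), h0]; rfl
  obtain ⟨e, he⟩ := hi
  have hinv : DifferentiableAt ℝ (fun y => (h y).inverse) x := by
    have h1 := contDiffAt_map_inverse (𝕜 := ℝ) (n := 1) e
    rw [he] at h1
    exact (h1.comp x (hh.contDiffAt.of_le (by norm_num))).differentiableAt (by norm_num)
  have hκ : HasFDerivAt (fun y => (1 / 2 : ℝ) • koszulCLM h y v w)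
      ((1 / 2 : ℝ) • fderiv ℝ (fun y => koszulCLM h y v w) x) x :=
    (hk x).hasFDerivAt.const_smul (1 / 2 : ℝ)
  have hF := hinv.hasFDerivAt.clm_apply hκ
  have hF' : fderiv ℝ (fun y => christoffel h y v w) x u =
      (h x).inverse ((1 / 2 : ℝ) • fderiv ℝ (fun y => koszulCLM h y v w) x u) := by
    have : (fun y => christoffel h y v w) =
      fun y => (h y).inverse ((1 / 2 : ℝ) • koszulCLM h y v w) := rfl
    rw [this, hF.fderiv]
    simp [hk0]
  have hK : fderiv ℝ (fun y => koszul h y v w t) x u =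
      fderiv ℝ (fun y => koszulCLM h y v w) x u t := by
    have : (fun y => koszul h y v w t) = fun y => koszulCLM h y v w t :=
      funext fun y => koszul_eq (hd y) v w t
    rw [this, ((hk x).hasFDerivAt.clm_apply (hasFDerivAt_const t x)).fderiv]
    simp
  rw [hF', hK, ← he, ContinuousLinearMap.inverse_equiv]
  simp

lemma christoffel_eq_zero {h : E → E →L[ℝ] E →L[ℝ] ℝ} {x : E} (hd : DifferentiableAt ℝ h x)
    {v w : E} (h0 : ∀ s, koszul h x v w s = 0) : christoffel h x v w = 0 := by
  have hk0 : koszulCLM h x v w = 0 := by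
    ext s
    rw [← koszul_eq hd, h0]; rfl
  change (h x).inverse ((1 / 2 : ℝ) • koszulCLM h x v w) = 0
  simp [hk0]

/-- The curvature at a point, in directions along which the Christoffel symbols vanish there. -/
lemma apply_curvatureInCoordinates [FiniteDimensional ℝ E] {h : E → E →L[ℝ] E →L[ℝ] ℝ}
    (hh : ContDiff ℝ 2 h) {x : E} (hi : (h x).IsInvertible) {u v w : E}
    (hvw : ∀ s, koszul h x v w s = 0) (huw : ∀ s, koszul h x u w s = 0) (t : E) :
    h x (curvatureInCoordinates h x u v w) t =
      1 / 2 * (fderiv ℝ (fun y => koszul h y v w t) x u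
        - fderiv ℝ (fun y => koszul h y u w t) x v) := by
  have hd : Differentiable ℝ h := hh.differentiable (by norm_num)
  -- Both inner Christoffel symbols are zero at `x`, which removes the terms quadratic in `Γ`.
  have hz (a : E) : christoffel h x a 0 = 0 := by simp [christoffel]
  rw [curvatureInCoordinates, christoffel_eq_zero (hd x) hvw, christoffel_eq_zero (hd x) huw,
    hz, hz, add_zero, sub_zero, map_sub, sub_apply,
    apply_fderiv_christoffel hh hi hvw, apply_fderiv_christoffel hh hi huw]
  ring

end Koszul

/-! ### Mixed curvature of a product metric with cross term `B (η₁ ⊗ η₂ + η₂ ⊗ η₁)`. -/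

section TwistedProduct

variable {E F : Type*} [NormedAddCommGroup E] [NormedSpace ℝ E]
  [NormedAddCommGroup F] [NormedSpace ℝ F]

lemma fderiv_mul_fst_snd {f : E → ℝ} {g : F → ℝ} (y : E × F)
    (hf : DifferentiableAt ℝ f y.1) (hg : DifferentiableAt ℝ g y.2) (θ : E × F) :
    fderiv ℝ (fun z : E × F => f z.1 * g z.2) y θ =
      fderiv ℝ f y.1 θ.1 * g y.2 + f y.1 * fderiv ℝ g y.2 θ.2 := by
  have h1 := hf.hasFDerivAt.comp y (hasFDerivAt_fst (𝕜 := ℝ) (E := E) (F := F) (p := y))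
  have h2 := hg.hasFDerivAt.comp y (hasFDerivAt_snd (𝕜 := ℝ) (E := E) (F := F) (p := y))
  have h3 := h1.mul h2
  have : fderiv ℝ (fun z : E × F => f z.1 * g z.2) y = _ := h3.fderiv
  rw [this]
  simp
  ring

/-- The metric `h` is, in product coordinates, the sum of `k₁`, `k₂` and `B (η₁ ⊗ η₂ + η₂ ⊗ η₁)`,
where `k₁` and the 1-form `η₁` live on the first factor and `k₂` and `η₂` on the second one. -/
structure IsTwistedProduct (h : E × F → (E × F) →L[ℝ] (E × F) →L[ℝ] ℝ) (B : ℝ)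
    (k₁ : E → E → E → ℝ) (k₂ : F → F → F → ℝ) (η₁ : E → E → ℝ) (η₂ : F → F → ℝ) : Prop where
  eq : ∀ y ξ ζ, h y ξ ζ = k₁ y.1 ξ.1 ζ.1 + k₂ y.2 ξ.2 ζ.2
    + B * (η₁ y.1 ξ.1 * η₂ y.2 ζ.2 + η₁ y.1 ζ.1 * η₂ y.2 ξ.2)
  contDiff_fst : ∀ u v, ContDiff ℝ 2 fun x => k₁ x u v
  contDiff_snd : ∀ u v, ContDiff ℝ 2 fun x => k₂ x u v
  contDiff_form_fst : ∀ u, ContDiff ℝ 2 fun x => η₁ x u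
  contDiff_form_snd : ∀ u, ContDiff ℝ 2 fun x => η₂ x u

namespace IsTwistedProduct

variable {h : E × F → (E × F) →L[ℝ] (E × F) →L[ℝ] ℝ} {B : ℝ}
    {k₁ : E → E → E → ℝ} {k₂ : F → F → F → ℝ} {η₁ : E → E → ℝ} {η₂ : F → F → ℝ}

lemma contDiff [FiniteDimensional ℝ E] [FiniteDimensional ℝ F]
    (H : IsTwistedProduct h B k₁ k₂ η₁ η₂) : ContDiff ℝ 2 h := by
  rw [contDiff_clm_apply_iff]
  intro ξ
  rw [contDiff_clm_apply_iff]
  intro ζ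
  simp only [H.eq]
  have h1 := (H.contDiff_fst ξ.1 ζ.1).comp (_root_.contDiff_fst (E := E) (F := F))
  have h2 := (H.contDiff_snd ξ.2 ζ.2).comp (_root_.contDiff_snd (E := E) (F := F))
  have h3 (a) := (H.contDiff_form_fst a).comp (_root_.contDiff_fst (E := E) (F := F))
  have h4 (a) := (H.contDiff_form_snd a).comp (_root_.contDiff_snd (E := E) (F := F))
  exact (h1.add h2).add (contDiff_const.mul
    (((h3 ξ.1).mul (h4 ζ.2)).add ((h3 ζ.1).mul (h4 ξ.2))))

lemma fderiv_apply (H : IsTwistedProduct h B k₁ k₂ η₁ η₂) (y ξ ζ θ : E × F) :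
    fderiv ℝ (fun z => h z ξ ζ) y θ =
      fderiv ℝ (fun x => k₁ x ξ.1 ζ.1) y.1 θ.1 + fderiv ℝ (fun x => k₂ x ξ.2 ζ.2) y.2 θ.2
      + B * (fderiv ℝ (fun x => η₁ x ξ.1) y.1 θ.1 * η₂ y.2 ζ.2
        + η₁ y.1 ξ.1 * fderiv ℝ (fun x => η₂ x ζ.2) y.2 θ.2
        + (fderiv ℝ (fun x => η₁ x ζ.1) y.1 θ.1 * η₂ y.2 ξ.2
        + η₁ y.1 ζ.1 * fderiv ℝ (fun x => η₂ x ξ.2) y.2 θ.2)) := by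
  have hk₁ (u v) := (H.contDiff_fst u v).differentiable (by norm_num)
  have hk₂ (u v) := (H.contDiff_snd u v).differentiable (by norm_num)
  have hη₁ (u) := (H.contDiff_form_fst u).differentiable (by norm_num)
  have hη₂ (u) := (H.contDiff_form_snd u).differentiable (by norm_num)
  have d1 : DifferentiableAt ℝ (fun z : E × F => k₁ z.1 ξ.1 ζ.1) y :=
    (hk₁ ξ.1 ζ.1).comp differentiable_fst y
  have d2 : DifferentiableAt ℝ (fun z : E × F => k₂ z.2 ξ.2 ζ.2) y :=
    (hk₂ ξ.2 ζ.2).comp differentiable_snd y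
  have d3 (a) : DifferentiableAt ℝ (fun z : E × F => η₁ z.1 a) y :=
    (hη₁ a).comp differentiable_fst y
  have d4 (a) : DifferentiableAt ℝ (fun z : E × F => η₂ z.2 a) y :=
    (hη₂ a).comp differentiable_snd y
  -- With the other factor constantly `1`, the product formula also covers functions of a single
  -- factor.
  have e1 := fderiv_mul_fst_snd (g := fun _ : F => (1 : ℝ)) y (hk₁ ξ.1 ζ.1 y.1) (by fun_prop) θ
  have e2 := fderiv_mul_fst_snd (f := fun _ : E => (1 : ℝ)) y (by fun_prop) (hk₂ ξ.2 ζ.2 y.2) θ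
  simp only [mul_one, one_mul, fderiv_fun_const, Pi.zero_apply, zero_apply,
    mul_zero, zero_mul, add_zero, zero_add] at e1 e2
  have e3 (a b) := fderiv_mul_fst_snd y (hη₁ a y.1) (hη₂ b y.2) θ
  simp only [H.eq]
  rw [fderiv_fun_add (by fun_prop) (by fun_prop), fderiv_fun_add (by fun_prop) (by fun_prop),
    fderiv_const_mul (by fun_prop), fderiv_fun_add (by fun_prop) (by fun_prop)]
  simp only [add_apply, smul_apply, smul_eq_mul, e1, e2, e3]

/-- The mixed components of the curvature of a twisted product. -/
lemma apply_curvature [FiniteDimensional ℝ E] [FiniteDimensional ℝ F]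
    (H : IsTwistedProduct h B k₁ k₂ η₁ η₂) (hη₁ : ∀ x, η₁ x 0 = 0) (hη₂ : ∀ x, η₂ x 0 = 0)
    (hk₁ : ∀ x u, k₁ x u 0 = 0 ∧ k₁ x 0 u = 0) (hk₂ : ∀ x u, k₂ x u 0 = 0 ∧ k₂ x 0 u = 0)
    {x : E × F} (hi : (h x).IsInvertible) {u t : E} {v w : F}
    (hu : η₁ x.1 u = 0) (hw : η₂ x.2 w = 0)
    (hut : fderiv ℝ (fun y => η₁ y t) x.1 u = - fderiv ℝ (fun y => η₁ y u) x.1 t)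
    (hvw : fderiv ℝ (fun y => η₂ y w) x.2 v = - fderiv ℝ (fun y => η₂ y v) x.2 w)
    (hΓ : ∀ s, fderiv ℝ (fun y => k₂ y w s) x.2 v + fderiv ℝ (fun y => k₂ y v s) x.2 w
      - fderiv ℝ (fun y => k₂ y v w) x.2 s = 0) :
    h x (curvatureInCoordinates h x (u, 0) (0, v) (0, w)) (t, 0) =
      -B * fderiv ℝ (fun y => η₁ y t) x.1 u * fderiv ℝ (fun y => η₂ y w) x.2 v := by
  -- The cross term enters only through the symmetrized derivative of `η₂`, which `hvw` makes zero
  -- at the point.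
  have K1 (y : E × F) (s : E × F) : koszul h y (0, v) (0, w) s =
      (fderiv ℝ (fun x => k₂ x w s.2) y.2 v + fderiv ℝ (fun x => k₂ x v s.2) y.2 w
        - fderiv ℝ (fun x => k₂ x v w) y.2 s.2)
      + B * (η₁ y.1 s.1 *
        (fderiv ℝ (fun x => η₂ x w) y.2 v + fderiv ℝ (fun x => η₂ x v) y.2 w)) := by
    simp only [koszul, H.fderiv_apply]
    simp [hη₁, hk₁]
    ring
  -- Here `k₁` and `k₂` cancel, and the antisymmetrized derivatives of the forms appear with
  -- coefficients `η₂ w` and `η₁ u`, both zero at the point.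
  have K2 (y : E × F) (s : E × F) : koszul h y (u, 0) (0, w) s =
      B * (η₂ y.2 w * (fderiv ℝ (fun x => η₁ x s.1) y.1 u - fderiv ℝ (fun x => η₁ x u) y.1 s.1)
        + η₁ y.1 u * (fderiv ℝ (fun x => η₂ x s.2) y.2 w - fderiv ℝ (fun x => η₂ x w) y.2 s.2)) := by
    simp only [koszul, H.fderiv_apply]
    simp [hη₁, hη₂, hk₁, hk₂]
    ring
  have dη₁ (a b) : Differentiable ℝ (fun y => fderiv ℝ (fun x => η₁ x a) y b) :=
    (((H.contDiff_form_fst a).fderiv_right (m := 1) (by norm_num)).differentiable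
      (by norm_num)).clm_apply (differentiable_const b)
  have dη₂ (a b) : Differentiable ℝ (fun y => fderiv ℝ (fun x => η₂ x a) y b) :=
    (((H.contDiff_form_snd a).fderiv_right (m := 1) (by norm_num)).differentiable
      (by norm_num)).clm_apply (differentiable_const b)
  rw [apply_curvatureInCoordinates H.contDiff hi]
  -- The derivative of the first expression along `u` keeps the vanishing symmetrized factor. That
  -- of the second along `v` hits `η₂ w`, against `∂_u η₁(t) - ∂_t η₁(u) = 2 ∂_u η₁(t)`; this 2
  -- cancels the one half.
  · have L1 : (fun y => koszul h y (0, v) (0, w) (t, 0)) = fun y : E × F => (B * η₁ y.1 t) *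
        (fderiv ℝ (fun x => η₂ x w) y.2 v + fderiv ℝ (fun x => η₂ x v) y.2 w) := by
      funext y
      simp [K1, hk₂]
      ring
    have L2 : (fun y => koszul h y (u, 0) (0, w) (t, 0)) = fun y : E × F =>
        (fderiv ℝ (fun x => η₁ x t) y.1 u - fderiv ℝ (fun x => η₁ x u) y.1 t) *
          (B * η₂ y.2 w) + (B * η₁ y.1 u) * (- fderiv ℝ (fun x => η₂ x w) y.2 0) := by
      funext y
      simp [K2, hη₂]
      ring
    have c1 := (H.contDiff_form_fst t).differentiable (by norm_num)
    have c2 := (H.contDiff_form_snd w).differentiable (by norm_num)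
    simp only [map_zero, neg_zero, mul_zero, add_zero] at L2
    rw [L1, L2, fderiv_mul_fst_snd (f := fun x => B * η₁ x t)
        (g := fun y => fderiv ℝ (fun x => η₂ x w) y v + fderiv ℝ (fun x => η₂ x v) y w) x
        (by fun_prop) (by fun_prop),
      fderiv_mul_fst_snd (g := fun x => B * η₂ x w)
        (f := fun y => fderiv ℝ (fun x => η₁ x t) y u - fderiv ℝ (fun x => η₁ x u) y t) x
        (by fun_prop) (by fun_prop), fderiv_const_mul (c2 _)]
    simp [hvw, hut, hw]
    ring
  · intro s
    rw [K1, hΓ, hvw]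
    ring
  · intro s
    rw [K2, hw, hu]
    ring

end IsTwistedProduct

end TwistedProduct

/-! ### The metric on tangent vectors, by Hermitian algebra. -/

section ComplexStructure

variable {n : ℕ}

/-- The multiplication by `i` as an isometry. -/
def mulI (n : ℕ) : CVec n ≃ₗᵢ[ℂ] CVec n where
  toLinearEquiv := LinearEquiv.smulOfNeZero ℂ (CVec n) Complex.I Complex.I_ne_zero
  norm_map' u := by
    change ‖Complex.I • u‖ = ‖u‖
    simp [norm_smul]

lemma inner_I_smul_I_smul (u v : CVec n) :
    inner ℝ (Complex.I • u) (Complex.I • v) = inner ℝ u v :=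
  inner_map_cVec (mulI n) u v

lemma inner_I_smul_left (u v : CVec n) :
    inner ℝ (Complex.I • u) v = - inner ℝ u (Complex.I • v) := by
  rw [← inner_I_smul_I_smul, smul_smul, Complex.I_mul_I, neg_one_smul, inner_neg_left]

lemma inner_I_smul_swap (u v : CVec n) :
    inner ℝ (Complex.I • u) v = - inner ℝ (Complex.I • v) u := by
  rw [inner_I_smul_left, real_inner_comm]

@[simp]
lemma inner_I_smul_self (u : CVec n) : inner ℝ (Complex.I • u) u = 0 := by
  have := inner_I_smul_swap u u
  linarith

@[simp]
lemma inner_self_I_smul (u : CVec n) : inner ℝ u (Complex.I • u) = 0 := by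
  rw [real_inner_comm, inner_I_smul_self]

lemma inner_horPart {z : CVec n} (hz : ‖z‖ = 1) (u v : CVec n) :
    inner ℝ (horPart z u) (horPart z v) = inner ℝ u v - hopfCoord z u * hopfCoord z v := by
  have h1 : inner ℝ z z = (1 : ℝ) := by rw [real_inner_self_eq_norm_sq, hz]; norm_num
  simp only [horPart, hopfCoord, inner_sub_left, inner_sub_right, real_inner_smul_left,
    real_inner_smul_right, inner_I_smul_I_smul, h1, real_inner_comm (Complex.I • z) u]
  ring

lemma inner_horPart_right {z : CVec n} (u : CVec n) (hu : inner ℝ z u = 0) :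
    inner ℝ z (horPart z u) = 0 := by
  simp [horPart, inner_sub_right, real_inner_smul_right, hu]

/-- The metric form on tangent vectors, in terms of the Hermitian inner products and the
coordinates along the Hopf circles. -/
lemma metricForm_apply {n p : ℕ} (a c : ℝ) {q ξ ζ : Ambient n p} (h1 : ‖q.1‖ = 1)
    (h2 : ‖q.2‖ = 1) (hζ₁ : inner ℝ q.1 ζ.1 = 0) (hζ₂ : inner ℝ q.2 ζ.2 = 0) :
    metricForm a c q ξ ζ =
      (inner ℝ ξ.1 ζ.1 + (1 / c - 1) * (hopfCoord q.1 ξ.1 * hopfCoord q.1 ζ.1))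
      + (inner ℝ ξ.2 ζ.2 + ((a ^ 2 + c ^ 2) / c - 1) * (hopfCoord q.2 ξ.2 * hopfCoord q.2 ζ.2))
      + -(a / c) * (hopfCoord q.1 ξ.1 * hopfCoord q.2 ζ.2
        + hopfCoord q.1 ζ.1 * hopfCoord q.2 ξ.2) := by
  -- Each component of `cpxStructure` has the form `i (horizontal) + r i z`. Tangency makes `i
  -- (horizontal)` orthogonal to `i z`, so `r` is its Hopf coordinate and the rest its horizontal
  -- part.
  have key {m : ℕ} {z u : CVec m} (hz : ‖z‖ = 1) (hu : inner ℝ z u = 0) (r : ℝ) :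
      hopfCoord z (Complex.I • horPart z u + r • Complex.I • z) = r := by
    have h1 : inner ℝ z z = (1 : ℝ) := by rw [real_inner_self_eq_norm_sq, hz]; norm_num
    rw [hopfCoord, inner_add_right, real_inner_smul_right, inner_I_smul_I_smul,
      inner_I_smul_I_smul, inner_horPart_right u hu, h1]
    ring
  have key' {m : ℕ} {z u : CVec m} (hz : ‖z‖ = 1) (hu : inner ℝ z u = 0) (r : ℝ) :
      horPart z (Complex.I • horPart z u + r • Complex.I • z) = Complex.I • horPart z u := by
    rw [horPart, key hz hu, add_sub_cancel_right]
  change omega q ξ (cpxStructure a c q ζ) = _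
  simp only [omega, cpxStructure, key h1 hζ₁, key h2 hζ₂, key' h1 hζ₁, key' h2 hζ₂,
    inner_I_smul_I_smul, inner_horPart h1, inner_horPart h2]
  ring

end ComplexStructure

/-! ### Pull-backs of the Hopf form and of the one-sphere metrics. -/

section PullBack

variable {E : Type*} [NormedAddCommGroup E] [NormedSpace ℝ E] {n : ℕ}

/-- The pull-back under `φ` of the 1-form `hopfCoord`. -/
def pullHopf (φ : E → CVec n) (x u : E) : ℝ := hopfCoord (φ x) (fderiv ℝ φ x u)

/-- The pull-back under `φ` of the inner product plus `A` times the square of `hopfCoord`. -/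
def pullForm (A : ℝ) (φ : E → CVec n) (x u v : E) : ℝ :=
  inner ℝ (fderiv ℝ φ x u) (fderiv ℝ φ x v) + A * (pullHopf φ x u * pullHopf φ x v)

lemma contDiff_pullHopf {φ : E → CVec n} (hφ : ContDiff ℝ 3 φ) (u : E) :
    ContDiff ℝ 2 fun x => pullHopf φ x u := by
  have h1 : ContDiff ℝ 2 fun x => fderiv ℝ φ x u :=
    (hφ.fderiv_right (m := 2) (by norm_num)).clm_apply contDiff_const
  have h2 : ContDiff ℝ 2 fun x => Complex.I • φ x :=
    (contDiff_const_smul (𝕜 := ℝ) Complex.I).comp (hφ.of_le (by norm_num))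
  exact h2.inner ℝ h1

lemma contDiff_pullForm (A : ℝ) {φ : E → CVec n} (hφ : ContDiff ℝ 3 φ) (u v : E) :
    ContDiff ℝ 2 fun x => pullForm A φ x u v := by
  have h1 (w : E) : ContDiff ℝ 2 fun x => fderiv ℝ φ x w :=
    (hφ.fderiv_right (m := 2) (by norm_num)).clm_apply contDiff_const
  exact ((h1 u).inner ℝ (h1 v)).add
    (contDiff_const.mul ((contDiff_pullHopf hφ u).mul (contDiff_pullHopf hφ v)))

end PullBack

/-! ### First and second derivatives of inverse stereographic projection. -/

section Stereographic

variable {E : Type*} [NormedAddCommGroup E] [InnerProductSpace ℝ E]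
  {V : Type*} [NormedAddCommGroup V] [InnerProductSpace ℝ V]

/-- The inverse of the stereographic projection, with values near `z` at the origin. -/
def stereoParam (U : E →ₗᵢ[ℝ] V) (z : V) (x : E) : V :=
  (‖x‖ ^ 2 + 4)⁻¹ • (4 : ℝ) • U x + (‖x‖ ^ 2 + 4)⁻¹ • (4 - ‖x‖ ^ 2) • z

lemma stereoParam_zero (U : E →ₗᵢ[ℝ] V) (z : V) : stereoParam U z 0 = z := by
  simp [stereoParam]

lemma contDiff_inv_norm_sq_add {m : WithTop ℕ∞} :
    ContDiff ℝ m fun x : E => (‖x‖ ^ 2 + 4)⁻¹ :=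
  ((contDiff_norm_sq ℝ).add contDiff_const).inv fun x => by positivity

lemma contDiff_stereoParam (U : E →ₗᵢ[ℝ] V) (z : V) {m : WithTop ℕ∞} :
    ContDiff ℝ m (stereoParam U z) := by
  have h1 : ContDiff ℝ m fun x : E => (‖x‖ ^ 2 + 4)⁻¹ := contDiff_inv_norm_sq_add
  have h2 : ContDiff ℝ m fun x => (4 : ℝ) • U x :=
    contDiff_const.smul U.toContinuousLinearMap.contDiff
  have h3 : ContDiff ℝ m fun x : E => (4 - ‖x‖ ^ 2) • z :=
    (contDiff_const.sub (contDiff_norm_sq ℝ)).smul contDiff_const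
  exact (h1.smul h2).add (h1.smul h3)

lemma fderiv_stereoParam (U : E →ₗᵢ[ℝ] V) (z : V) (x u : E) :
    fderiv ℝ (stereoParam U z) x u = (4 * (‖x‖ ^ 2 + 4)⁻¹) • U u
      - (8 * ((‖x‖ ^ 2 + 4)⁻¹) ^ 2 * inner ℝ x u) • (U x + (2 : ℝ) • z) := by
  have hr : HasFDerivAt (fun x : E => ‖x‖ ^ 2) (2 • innerSL ℝ x) x :=
    (hasStrictFDerivAt_norm_sq x).hasFDerivAt
  have hne : ‖x‖ ^ 2 + 4 ≠ 0 := by positivity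
  have h1 := (hasDerivAt_inv hne).comp_hasFDerivAt x (hr.add_const 4)
  have h2 : HasFDerivAt (fun x => (4 : ℝ) • U x) ((4 : ℝ) • U.toContinuousLinearMap) x :=
    U.toContinuousLinearMap.hasFDerivAt.const_smul (4 : ℝ)
  have h3 := ((hr.const_sub 4).smul_const z)
  have h4 := (h1.smul h2).add (h1.smul h3)
  have h5 : fderiv ℝ (stereoParam U z) x = _ := h4.fderiv
  rw [h5]
  simp
  match_scalars <;> field_simp <;> ring

lemma fderiv_stereoParam_zero (U : E →ₗᵢ[ℝ] V) (z : V) (u : E) :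
    fderiv ℝ (stereoParam U z) 0 u = U u := by
  simp [fderiv_stereoParam]

/-- The second derivative at the origin is a multiple of `z`. When the image of `U` is orthogonal to
`z`, it is therefore normal to the sphere, and the round metric has no first-order term in these
coordinates. -/
lemma hasFDerivAt_fderiv_stereoParam (U : E →ₗᵢ[ℝ] V) (z : V) (u : E) :
    HasFDerivAt (fun x => fderiv ℝ (stereoParam U z) x u)
      (-((innerSL ℝ u).smulRight z)) 0 := by
  have hr : HasFDerivAt (fun x : E => ‖x‖ ^ 2) (2 • innerSL ℝ (0 : E)) 0 :=
    (hasStrictFDerivAt_norm_sq 0).hasFDerivAt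
  have hne : ‖(0 : E)‖ ^ 2 + 4 ≠ 0 := by positivity
  have h1 : HasFDerivAt (fun x : E => (‖x‖ ^ 2 + 4)⁻¹) (0 : E →L[ℝ] ℝ) 0 := by
    have := (hasDerivAt_inv hne).comp_hasFDerivAt (0 : E) (hr.add_const 4)
    exact this.congr_fderiv (by simp)
  have h2 : HasFDerivAt (fun x : E => inner ℝ x u) (innerSL ℝ u) 0 := by
    simp only [real_inner_comm u]
    exact (innerSL ℝ u).hasFDerivAt
  have h3 : HasFDerivAt (fun x : E => U x + (2 : ℝ) • z) U.toContinuousLinearMap 0 :=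
    U.toContinuousLinearMap.hasFDerivAt.add_const _
  have h4 := ((h1.const_mul 4).smul_const (U u)).sub
    ((((h1.pow 2).const_mul 8).mul h2).smul h3)
  simp only [fderiv_stereoParam]
  refine h4.congr_fderiv ?_
  ext t
  simp
  match_scalars
  norm_num
  ring

end Stereographic

/-! ### First derivatives of the pulled-back tensors at the origin. -/

section PullBackStereographic

variable {E : Type*} [NormedAddCommGroup E] [InnerProductSpace ℝ E] {n : ℕ}

lemma pullHopf_zero (U : E →ₗᵢ[ℝ] CVec n) (z : CVec n) (u : E) :
    pullHopf (stereoParam U z) 0 u = hopfCoord z (U u) := by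
  rw [pullHopf, stereoParam_zero, fderiv_stereoParam_zero]

lemma hasFDerivAt_stereoParam_zero (U : E →ₗᵢ[ℝ] CVec n) (z : CVec n) :
    HasFDerivAt (stereoParam U z) U.toContinuousLinearMap 0 := by
  have := ((contDiff_stereoParam U z (m := 1)).differentiable (by norm_num) 0).hasFDerivAt
  refine this.congr_fderiv ?_
  ext1 u
  exact fderiv_stereoParam_zero U z u

/-- The second-derivative term pairs `i z` with a multiple of `z` and vanishes; only the derivative
of the point `i z` contributes. The result is antisymmetric in `u` and `t`. -/
lemma fderiv_pullHopf (U : E →ₗᵢ[ℝ] CVec n) (z : CVec n) (u t : E) :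
    fderiv ℝ (fun x => pullHopf (stereoParam U z) x u) 0 t = inner ℝ (Complex.I • U t) (U u) := by
  have h1 : HasFDerivAt (fun x => Complex.I • stereoParam U z x)
      (Complex.I • U.toContinuousLinearMap) 0 :=
    (hasFDerivAt_stereoParam_zero U z).const_smul Complex.I
  have h2 := h1.inner ℝ (hasFDerivAt_fderiv_stereoParam U z u)
  have h3 : fderiv ℝ (fun x => pullHopf (stereoParam U z) x u) 0 = _ := h2.fderiv
  rw [h3]
  simp [stereoParam_zero, fderiv_stereoParam_zero, real_inner_smul_right]

/-- By `hz` the round part contributes nothing, so only the `A`-term is differentiated. -/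
lemma fderiv_pullForm (A : ℝ) (U : E →ₗᵢ[ℝ] CVec n) {z : CVec n} (hz : ∀ x, inner ℝ z (U x) = 0)
    (u v t : E) :
    fderiv ℝ (fun x => pullForm A (stereoParam U z) x u v) 0 t =
      A * (inner ℝ (Complex.I • U t) (U u) * hopfCoord z (U v)
        + hopfCoord z (U u) * inner ℝ (Complex.I • U t) (U v)) := by
  have h1 := (hasFDerivAt_fderiv_stereoParam U z u).inner ℝ (hasFDerivAt_fderiv_stereoParam U z v)
  have hd (w : E) := ((contDiff_pullHopf (contDiff_stereoParam U z) w).differentiable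
    (by norm_num) 0).hasFDerivAt
  have h2 := h1.add (((hd u).mul (hd v)).const_mul A)
  have h3 : fderiv ℝ (fun x => pullForm A (stereoParam U z) x u v) 0 = _ := h2.fderiv
  rw [h3]
  have hz' (x) : inner ℝ (U x) z = 0 := by rw [real_inner_comm, hz]
  simp [fderiv_stereoParam_zero, real_inner_smul_right, real_inner_smul_left, hz, hz',
    fderiv_pullHopf, pullHopf_zero]
  ring

end PullBackStereographic

/-! ### From the manifold definitions to stereographic coordinates. -/

section Charts

variable {n p : ℕ}

/-- The chart around `z` projects from `-z`, which puts `z` at the origin and reverses the sign of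
the last term of the usual formula. `U` identifies the coordinate space with the orthogonal
complement of `z`. -/
lemma exists_extChartAt_symm_eq (z : sphere (0 : CVec n) 1) :
    ∃ U : EuclideanSpace ℝ (Fin (2 * n + 1)) →ₗᵢ[ℝ] CVec n,
      (∀ x, inner ℝ (z : CVec n) (U x) = 0) ∧
      ∀ x, (((extChartAt (𝓡 (2 * n + 1)) z).symm x : sphere (0 : CVec n) 1) : CVec n) =
        stereoParam U (z : CVec n) x := by
  let W := (OrthonormalBasis.fromOrthogonalSpanSingleton (𝕜 := ℝ) (2 * n + 1)
    (ne_zero_of_mem_unit_sphere (-z))).repr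
  refine ⟨(ℝ ∙ ((-z : sphere (0 : CVec n) 1) : CVec n))ᗮ.subtypeₗᵢ.comp
    W.symm.toLinearIsometry, fun x => ?_, fun x => ?_⟩
  · have h := (W.symm x).2
    rw [Submodule.mem_orthogonal_singleton_iff_inner_right] at h
    simp only [coe_neg_sphere, inner_neg_left, neg_eq_zero] at h
    exact h
  · have h := stereographic'_symm_apply (n := 2 * n + 1) (-z) x
    have e : (extChartAt (𝓡 (2 * n + 1)) z).symm x = (stereographic' (2 * n + 1) (-z)).symm x := by
      simp [extChartAt, chartAt]
      rfl
    have hW : ‖((W.symm x : (ℝ ∙ ((-z : sphere (0 : CVec n) 1) : CVec n))ᗮ) : CVec n)‖ = ‖x‖ := by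
      rw [Submodule.norm_coe, W.symm.norm_map]
    rw [e, h, stereoParam]
    change (‖((W.symm x : (ℝ ∙ ((-z : sphere (0 : CVec n) 1) : CVec n))ᗮ) : CVec n)‖ ^ 2 + 4)⁻¹ •
      (4 : ℝ) • ((W.symm x : (ℝ ∙ ((-z : sphere (0 : CVec n) 1) : CVec n))ᗮ) : CVec n) +
      (‖((W.symm x : (ℝ ∙ ((-z : sphere (0 : CVec n) 1) : CVec n))ᗮ) : CVec n)‖ ^ 2 + 4)⁻¹ •
      (‖((W.symm x : (ℝ ∙ ((-z : sphere (0 : CVec n) 1) : CVec n))ᗮ) : CVec n)‖ ^ 2 - 4) •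
        ((-z : sphere (0 : CVec n) 1) : CVec n) = _
    rw [hW]
    congr 2
    rw [coe_neg_sphere, smul_neg, ← neg_smul, neg_sub]

/-- Stereographic projection is onto, so the coordinate metric is defined and smooth on the whole
vector space and no neighbourhoods need tracking. -/
lemma mem_extChartAt_sphere_target (z : sphere (0 : CVec n) 1)
    (x : EuclideanSpace ℝ (Fin (2 * n + 1))) : x ∈ (extChartAt (𝓡 (2 * n + 1)) z).target := by
  have h : (chartAt (EuclideanSpace ℝ (Fin (2 * n + 1))) z).target = Set.univ :=
    stereographic'_target (-z)
  simp [h]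

lemma extChartAt_sphere_self (z : sphere (0 : CVec n) 1) :
    extChartAt (𝓡 (2 * n + 1)) z z = 0 := by
  obtain ⟨U, -, hU⟩ := exists_extChartAt_symm_eq z
  have h : (extChartAt (𝓡 (2 * n + 1)) z).symm 0 = z :=
    Subtype.ext ((hU 0).trans (stereoParam_zero U _))
  nth_rewrite 2 [← h]
  exact (extChartAt (𝓡 (2 * n + 1)) z).right_inv (mem_extChartAt_sphere_target z 0)

/-- The inclusion of `S^{2n+1} × S^{2p+1}` in the chart around `q`. -/
def inclInChart (q : SphereProd n p)
    (x : EuclideanSpace ℝ (Fin (2 * n + 1)) × EuclideanSpace ℝ (Fin (2 * p + 1))) : Ambient n p :=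
  incl ((extChartAt (sphereModel n p) q).symm x)

lemma mdifferentiable_incl :
    MDifferentiable (sphereModel n p) 𝓘(ℝ, Ambient n p) (incl (n := n) (p := p)) := by
  have h1 : ContMDiff (sphereModel n p) 𝓘(ℝ, CVec n) 1 fun q : SphereProd n p => (q.1 : CVec n) :=
    (contMDiff_coe_sphere (m := 1)).comp contMDiff_fst
  have h2 : ContMDiff (sphereModel n p) 𝓘(ℝ, CVec p) 1 fun q : SphereProd n p => (q.2 : CVec p) :=
    (contMDiff_coe_sphere (m := 1)).comp contMDiff_snd
  exact (h1.prodMk_space h2).mdifferentiable (by norm_num)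

lemma mem_extChartAt_target (q : SphereProd n p)
    (x : EuclideanSpace ℝ (Fin (2 * n + 1)) × EuclideanSpace ℝ (Fin (2 * p + 1))) :
    x ∈ (extChartAt (sphereModel n p) q).target := by
  rw [extChartAt_prod]
  exact ⟨mem_extChartAt_sphere_target q.1 x.1, mem_extChartAt_sphere_target q.2 x.2⟩

lemma metricInChart_metric (a c : ℝ) (q : SphereProd n p)
    (x ξ ζ : EuclideanSpace ℝ (Fin (2 * n + 1)) × EuclideanSpace ℝ (Fin (2 * p + 1))) :
    metricInChart (sphereModel n p) (metric n p a c) q x ξ ζ =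
      metricForm a c (inclInChart q x) (fderiv ℝ (inclInChart q) x ξ)
        (fderiv ℝ (inclInChart q) x ζ) := by
  have hs : MDifferentiableAt
      𝓘(ℝ, EuclideanSpace ℝ (Fin (2 * n + 1)) × EuclideanSpace ℝ (Fin (2 * p + 1)))
      (sphereModel n p) (extChartAt (sphereModel n p) q).symm x := by
    have := mdifferentiableWithinAt_extChartAt_symm (mem_extChartAt_target q x)
    rwa [ModelWithCorners.range_eq_univ, mdifferentiableWithinAt_univ] at this
  have h := mfderiv_comp x (mdifferentiable_incl _) hs
  have hf : fderiv ℝ (inclInChart q) x = _ := mfderiv_eq_fderiv.symm.trans h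
  rw [hf]
  rfl

lemma dIncl_eq_fderiv (q : SphereProd n p) (u : TangentSpace (sphereModel n p) q) :
    dIncl q u = fderiv ℝ (inclInChart q) (extChartAt (sphereModel n p) q q) u := by
  have := (mdifferentiable_incl q).mvfderiv
  rw [dIncl, this, ModelWithCorners.range_eq_univ, fderivWithin_univ]
  rfl

/-- The tangent space at `q` is the model space seen through the chart around `q`, so the
differential of that chart at `q` is the identity. -/
lemma curvature_eq (g : ∀ q : SphereProd n p, TangentSpace (sphereModel n p) q →L[ℝ]
      TangentSpace (sphereModel n p) q →L[ℝ] ℝ) (q : SphereProd n p)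
    (u v w : TangentSpace (sphereModel n p) q) :
    curvature (sphereModel n p) g q u v w =
      curvatureInCoordinates (metricInChart (sphereModel n p) g q)
          (extChartAt (sphereModel n p) q q) u v w := by
  have hd : mvfderiv (sphereModel n p) (extChartAt (sphereModel n p) q) q =
      ContinuousLinearMap.id ℝ _ := mfderiv_extChartAt_self
  change (mvfderiv (sphereModel n p) (extChartAt (sphereModel n p) q) q).inverse
    (curvatureInCoordinates (metricInChart (sphereModel n p) g q)
      (extChartAt (sphereModel n p) q q)
      (mvfderiv (sphereModel n p) (extChartAt (sphereModel n p) q) q u)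
      (mvfderiv (sphereModel n p) (extChartAt (sphereModel n p) q) q v)
      (mvfderiv (sphereModel n p) (extChartAt (sphereModel n p) q) q w)) = _
  rw [hd]
  exact congrFun (congrArg DFunLike.coe ContinuousLinearMap.inverse_id) _

lemma metric_eq_metricInChart (a c : ℝ) (q : SphereProd n p)
    (u v : TangentSpace (sphereModel n p) q) :
    metric n p a c q u v = metricInChart (sphereModel n p) (metric n p a c) q
      (extChartAt (sphereModel n p) q q) u v := by
  have hi : inclInChart q (extChartAt (sphereModel n p) q q) = incl q := by
    rw [inclInChart, extChartAt_to_inv]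
  refine Eq.trans ?_ (metricInChart_metric a c q _ u v).symm
  rw [hi]
  exact congrArg₂ (fun y z => metricForm a c (incl q) y z) (dIncl_eq_fderiv q u)
    (dIncl_eq_fderiv q v)

end Charts

/-! ### The coordinate metric is a nondegenerate twisted product. -/

section MetricInChart

variable {n p : ℕ}

lemma inner_fderiv_eq_zero {E V : Type*} [NormedAddCommGroup E] [NormedSpace ℝ E]
    [NormedAddCommGroup V] [InnerProductSpace ℝ V] {φ : E → V} {r : ℝ} (h : ∀ x, ‖φ x‖ = r)
    {x : E} (hd : DifferentiableAt ℝ φ x) (u : E) : inner ℝ (φ x) (fderiv ℝ φ x u) = 0 := by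
  have h1 := (hd.hasFDerivAt.inner ℝ hd.hasFDerivAt).fderiv
  have h2 : (fun x => inner ℝ (φ x) (φ x)) = fun _ => r ^ 2 := by
    funext x
    rw [real_inner_self_eq_norm_sq, h]
  rw [h2, fderiv_fun_const] at h1
  have h3 := congrArg (fun L => L u) h1
  simp [real_inner_comm (φ x)] at h3
  linarith

lemma exists_inclInChart_eq (q : SphereProd n p) :
    ∃ (U₁ : EuclideanSpace ℝ (Fin (2 * n + 1)) →ₗᵢ[ℝ] CVec n)
      (U₂ : EuclideanSpace ℝ (Fin (2 * p + 1)) →ₗᵢ[ℝ] CVec p),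
      (∀ x, inner ℝ (q.1 : CVec n) (U₁ x) = 0) ∧ (∀ x, inner ℝ (q.2 : CVec p) (U₂ x) = 0) ∧
      (∀ x, ‖stereoParam U₁ (q.1 : CVec n) x‖ = 1) ∧
      (∀ x, ‖stereoParam U₂ (q.2 : CVec p) x‖ = 1) ∧
      inclInChart q = fun x => (stereoParam U₁ (q.1 : CVec n) x.1,
        stereoParam U₂ (q.2 : CVec p) x.2) := by
  obtain ⟨U₁, h₁, e₁⟩ := exists_extChartAt_symm_eq q.1
  obtain ⟨U₂, h₂, e₂⟩ := exists_extChartAt_symm_eq q.2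
  refine ⟨U₁, U₂, h₁, h₂, fun x => ?_, fun x => ?_, ?_⟩
  · rw [← e₁, norm_eq_of_mem_sphere]
  · rw [← e₂, norm_eq_of_mem_sphere]
  · funext x
    rw [← e₁, ← e₂, inclInChart, extChartAt_prod]
    rfl

lemma fderiv_prod_stereoParam {E F V W : Type*} [NormedAddCommGroup E] [InnerProductSpace ℝ E]
    [NormedAddCommGroup F] [InnerProductSpace ℝ F] [NormedAddCommGroup V] [InnerProductSpace ℝ V]
    [NormedAddCommGroup W] [InnerProductSpace ℝ W] (U₁ : E →ₗᵢ[ℝ] V) (U₂ : F →ₗᵢ[ℝ] W)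
    (z₁ : V) (z₂ : W) (x ξ : E × F) :
    fderiv ℝ (fun x : E × F => (stereoParam U₁ z₁ x.1, stereoParam U₂ z₂ x.2)) x ξ =
      (fderiv ℝ (stereoParam U₁ z₁) x.1 ξ.1, fderiv ℝ (stereoParam U₂ z₂) x.2 ξ.2) := by
  have d₁ := ((contDiff_stereoParam U₁ z₁ (m := 1)).differentiable (by norm_num) x.1).hasFDerivAt
  have d₂ := ((contDiff_stereoParam U₂ z₂ (m := 1)).differentiable (by norm_num) x.2).hasFDerivAt
  have h : fderiv ℝ (fun x : E × F => (stereoParam U₁ z₁ x.1, stereoParam U₂ z₂ x.2)) x = _ :=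
    ((d₁.comp x (hasFDerivAt_fst (𝕜 := ℝ))).prodMk (d₂.comp x (hasFDerivAt_snd (𝕜 := ℝ)))).fderiv
  rw [h]
  rfl

/-- The constants come from `g(X^1,X^1) = 1/c`, `g(X^2,X^2) = (a²+c²)/c` and `g(X^1,X^2) = -a/c`;
the first two are reduced by 1 because the round metric already counts the Hopf direction once.
Tangency follows by differentiating `‖φ‖ = 1`. -/
lemma isTwistedProduct_metricInChart (a c : ℝ) {q : SphereProd n p}
    {U₁ : EuclideanSpace ℝ (Fin (2 * n + 1)) →ₗᵢ[ℝ] CVec n}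
    {U₂ : EuclideanSpace ℝ (Fin (2 * p + 1)) →ₗᵢ[ℝ] CVec p}
    (n₁ : ∀ x, ‖stereoParam U₁ (q.1 : CVec n) x‖ = 1)
    (n₂ : ∀ x, ‖stereoParam U₂ (q.2 : CVec p) x‖ = 1)
    (hq : inclInChart q = fun x => (stereoParam U₁ (q.1 : CVec n) x.1,
        stereoParam U₂ (q.2 : CVec p) x.2)) :
    IsTwistedProduct (metricInChart (sphereModel n p) (metric n p a c) q) (-(a / c))
      (pullForm (1 / c - 1) (stereoParam U₁ (q.1 : CVec n)))
      (pullForm ((a ^ 2 + c ^ 2) / c - 1) (stereoParam U₂ (q.2 : CVec p)))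
      (pullHopf (stereoParam U₁ (q.1 : CVec n))) (pullHopf (stereoParam U₂ (q.2 : CVec p))) where
  eq y ξ ζ := by
    have t₁ := inner_fderiv_eq_zero n₁
      ((contDiff_stereoParam U₁ _ (m := 1)).differentiable (by norm_num) y.1) ζ.1
    have t₂ := inner_fderiv_eq_zero n₂
      ((contDiff_stereoParam U₂ _ (m := 1)).differentiable (by norm_num) y.2) ζ.2
    rw [metricInChart_metric, hq, fderiv_prod_stereoParam, fderiv_prod_stereoParam]
    exact metricForm_apply a c
      (q := (stereoParam U₁ (q.1 : CVec n) y.1, stereoParam U₂ (q.2 : CVec p) y.2))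
      (ξ := (fderiv ℝ (stereoParam U₁ (q.1 : CVec n)) y.1 ξ.1,
        fderiv ℝ (stereoParam U₂ (q.2 : CVec p)) y.2 ξ.2))
      (ζ := (fderiv ℝ (stereoParam U₁ (q.1 : CVec n)) y.1 ζ.1,
        fderiv ℝ (stereoParam U₂ (q.2 : CVec p)) y.2 ζ.2)) (n₁ y.1) (n₂ y.2) t₁ t₂
  contDiff_fst := contDiff_pullForm _ (contDiff_stereoParam U₁ _)
  contDiff_snd := contDiff_pullForm _ (contDiff_stereoParam U₂ _)
  contDiff_form_fst := contDiff_pullHopf (contDiff_stereoParam U₁ _)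
  contDiff_form_snd := contDiff_pullHopf (contDiff_stereoParam U₂ _)

lemma isInvertible_of_definite {E : Type*} [NormedAddCommGroup E] [NormedSpace ℝ E]
    [FiniteDimensional ℝ E] (b : E →L[ℝ] E →L[ℝ] ℝ) (hb : ∀ x, b x x = 0 → x = 0) :
    b.IsInvertible := by
  have hinj : Function.Injective b := by
    rw [injective_iff_map_eq_zero]
    intro x hx
    exact hb x (by rw [hx]; rfl)
  have hdim : finrank ℝ E = finrank ℝ (E →L[ℝ] ℝ) := by
    rw [← (LinearMap.toContinuousLinearMap (𝕜 := ℝ) (E := E) (F' := ℝ)).finrank_eq]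
    exact (Subspace.dual_finrank_eq (K := ℝ) (V := E)).symm
  let e := LinearEquiv.ofInjectiveOfFinrankEq b.toLinearMap hinj hdim
  exact ⟨e.toContinuousLinearEquiv, by ext; rfl⟩

lemma isInvertible_metricInChart {a c : ℝ} (hc : 0 < c) {q : SphereProd n p}
    {U₁ : EuclideanSpace ℝ (Fin (2 * n + 1)) →ₗᵢ[ℝ] CVec n}
    {U₂ : EuclideanSpace ℝ (Fin (2 * p + 1)) →ₗᵢ[ℝ] CVec p}
    (H : IsTwistedProduct (metricInChart (sphereModel n p) (metric n p a c) q) (-(a / c))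
      (pullForm (1 / c - 1) (stereoParam U₁ (q.1 : CVec n)))
      (pullForm ((a ^ 2 + c ^ 2) / c - 1) (stereoParam U₂ (q.2 : CVec p)))
      (pullHopf (stereoParam U₁ (q.1 : CVec n))) (pullHopf (stereoParam U₂ (q.2 : CVec p)))) :
    (metricInChart (sphereModel n p) (metric n p a c) q 0).IsInvertible := by
  refine isInvertible_of_definite _ fun ξ hξ => ?_
  rw [H.eq] at hξ
  simp only [pullForm, Prod.fst_zero, Prod.snd_zero, fderiv_stereoParam_zero, pullHopf_zero] at hξ
  set s := hopfCoord (q.1 : CVec n) (U₁ ξ.1)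
  set t := hopfCoord (q.2 : CVec p) (U₂ ξ.2)
  have h1 := inner_horPart (norm_eq_of_mem_sphere q.1) (U₁ ξ.1) (U₁ ξ.1)
  have h2 := inner_horPart (norm_eq_of_mem_sphere q.2) (U₂ ξ.2) (U₂ ξ.2)
  have p1 : 0 ≤ inner ℝ (U₁ ξ.1) (U₁ ξ.1) - s * s := h1 ▸ real_inner_self_nonneg
  have p2 : 0 ≤ inner ℝ (U₂ ξ.2) (U₂ ξ.2) - t * t := h2 ▸ real_inner_self_nonneg
  -- Completing the square on the Hopf plane: `s²/c - 2ast/c + (a²+c²)t²/c = (s - at)²/c + ct²`.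
  -- With the squared norms of the horizontal parts, every summand is nonnegative as `c > 0`.
  have hsum : (inner ℝ (U₁ ξ.1) (U₁ ξ.1) - s * s) + (inner ℝ (U₂ ξ.2) (U₂ ξ.2) - t * t)
      + ((s - a * t) ^ 2 / c + c * t ^ 2) = 0 := by
    rw [← hξ]
    field_simp
    ring
  have p3 : 0 ≤ (s - a * t) ^ 2 / c := by positivity
  have p4 : 0 ≤ c * t ^ 2 := by positivity
  have ht : t = 0 := by
    have : c * t ^ 2 = 0 := by linarith
    simpa [hc.ne'] using this
  have hs : s = 0 := by
    have : (s - a * t) ^ 2 / c = 0 := by linarith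
    simpa [hc.ne', ht] using this
  have hss : s * s = 0 := by rw [hs, mul_zero]
  have htt : t * t = 0 := by rw [ht, mul_zero]
  have e1 : inner ℝ (U₁ ξ.1) (U₁ ξ.1) = (0 : ℝ) := by linarith
  have e2 : inner ℝ (U₂ ξ.2) (U₂ ξ.2) = (0 : ℝ) := by linarith
  rw [inner_self_eq_zero] at e1 e2
  exact Prod.ext ((map_eq_zero_iff U₁ U₁.injective).1 e1) ((map_eq_zero_iff U₂ U₂.injective).1 e2)

/-- The components of the curvature of `g(a, c)` on two horizontal vectors `u`, `t` of the first
sphere and two horizontal vectors `v`, `w` of the second one. -/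
lemma metric_curvature {a c : ℝ} (hc : 0 < c) (q : SphereProd n p)
    {u v w t : TangentSpace (sphereModel n p) q} {u' t' : CVec n} {v' w' : CVec p}
    (hu : dIncl q u = (u', 0)) (ht : dIncl q t = (t', 0))
    (hv : dIncl q v = (0, v')) (hw : dIncl q w = (0, w'))
    (hu0 : hopfCoord (q.1 : CVec n) u' = 0)
    (hv0 : hopfCoord (q.2 : CVec p) v' = 0) (hw0 : hopfCoord (q.2 : CVec p) w' = 0) :
    metric n p a c q (curvature (sphereModel n p) (metric n p a c) q u v w) t =
      a / c * inner ℝ (Complex.I • u') t' * inner ℝ (Complex.I • v') w' := by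
  obtain ⟨U₁, U₂, o₁, o₂, n₁, n₂, hq⟩ := exists_inclInChart_eq q
  have H := isTwistedProduct_metricInChart a c n₁ n₂ hq
  have hx0 : extChartAt (sphereModel n p) q q = 0 := by
    rw [extChartAt_prod]
    exact Prod.ext (extChartAt_sphere_self q.1) (extChartAt_sphere_self q.2)
  -- At the origin the inclusion has differential `U₁ × U₂`. Injectivity then turns the hypotheses
  -- on images into vanishing of one coordinate component.
  have hdI (ξ : TangentSpace (sphereModel n p) q) : dIncl q ξ = (U₁ ξ.1, U₂ ξ.2) := by
    rw [dIncl_eq_fderiv, hx0, hq]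
    refine (fderiv_prod_stereoParam U₁ U₂ _ _ 0 ξ).trans ?_
    exact Prod.ext (fderiv_stereoParam_zero U₁ _ _) (fderiv_stereoParam_zero U₂ _ _)
  rw [metric_eq_metricInChart, curvature_eq, hx0]
  rw [hdI] at hu ht hv hw
  obtain ⟨u₁, u₂⟩ := u
  obtain ⟨t₁, t₂⟩ := t
  obtain ⟨v₁, v₂⟩ := v
  obtain ⟨w₁, w₂⟩ := w
  simp only [Prod.mk.injEq, map_eq_zero_iff U₁ U₁.injective,
    map_eq_zero_iff U₂ U₂.injective] at hu ht hv hw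
  obtain ⟨rfl, rfl⟩ := hu
  obtain ⟨rfl, rfl⟩ := ht
  obtain ⟨rfl, rfl⟩ := hv
  obtain ⟨rfl, rfl⟩ := hw
  refine (H.apply_curvature ?_ ?_ ?_ ?_ (isInvertible_metricInChart hc H) ?_ ?_ ?_ ?_ ?_).trans ?_
  · intro x; simp [pullHopf, hopfCoord]
  · intro x; simp [pullHopf, hopfCoord]
  · intro x u; simp [pullForm, pullHopf, hopfCoord]
  · intro x u; simp [pullForm, pullHopf, hopfCoord]
  · exact (pullHopf_zero _ _ _).trans hu0
  · exact (pullHopf_zero _ _ _).trans hw0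
  · simp only [Prod.fst_zero, fderiv_pullHopf]
    exact inner_I_smul_swap _ _
  · simp only [Prod.snd_zero, fderiv_pullHopf]
    exact inner_I_smul_swap _ _
  -- For horizontal `v`, `w` the remaining terms are `A η₂(s) (⟨i v, w⟩ + ⟨i w, v⟩)`, zero by
  -- antisymmetry.
  · intro s
    simp only [Prod.snd_zero, fderiv_pullForm _ _ o₂, hv0, hw0,
      inner_I_smul_swap (U₂ w₂) (U₂ v₂)]
    ring
  · simp only [Prod.fst_zero, Prod.snd_zero, fderiv_pullHopf, neg_neg]

end MetricInChart

/-! ### The horizontal frame and its symplectic pairings. -/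

section Frame

/-- The vector `Y_k e_0` of `ℂ^{n+1}`. -/
def horVec (n k : ℕ) : CVec n := Matrix.toEuclideanLin (matY n k) (baseVec n)

lemma horVec_apply (n k : ℕ) (i : Fin (n + 1)) : horVec n k i = matY n k i 0 := by
  simp [horVec, baseVec, Matrix.toLpLin_apply]

lemma horVec_odd {n l : ℕ} (h1 : 1 ≤ l) (h2 : l ≤ n) :
    horVec n (2 * l - 1) = EuclideanSpace.single ⟨l, by omega⟩ 1 := by
  have ho : ¬ Even (2 * l - 1) := by
    rw [Nat.even_iff]; omega
  have hl : (2 * l - 1 + 1) / 2 = l := by omega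
  -- Because `l ≠ 0`, the matrix unit `E_{0l}` kills `e_0`, and only `E_{l0}` acts.
  have h0 : (0 : ℕ) ≠ l := by omega
  ext i
  rw [horVec_apply, matY, if_neg ho, hl]
  by_cases hi : i = ⟨l, by omega⟩
  · simp [matZ, matE, h0, hi]
  · have hi' : (i : ℕ) ≠ l := fun h => hi (Fin.ext h)
    simp [matZ, matE, h0, hi, hi']

lemma horVec_even {n l : ℕ} (h1 : 1 ≤ l) (h2 : l ≤ n) :
    horVec n (2 * l) = Complex.I • EuclideanSpace.single ⟨l, by omega⟩ 1 := by
  have hl : (2 * l) / 2 = l := by omega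
  have h0 : (0 : ℕ) ≠ l := by omega
  ext i
  rw [horVec_apply, matY, if_pos (even_two_mul l), hl]
  by_cases hi : i = ⟨l, by omega⟩
  · simp [matT, matE, h0, hi]
  · have hi' : (i : ℕ) ≠ l := fun h => hi (Fin.ext h)
    simp [matT, matE, h0, hi, hi']

lemma inner_single {n : ℕ} (i j : Fin (n + 1)) :
    inner ℝ (EuclideanSpace.single i 1 : CVec n) (EuclideanSpace.single j 1) =
      if i = j then (1 : ℝ) else 0 := by
  rw [PiLp.inner_apply, Finset.sum_eq_single i]
  · by_cases h : i = j <;> simp [h]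
  · intro b _ hb; simp [hb]
  · simp

lemma inner_I_smul_single {n : ℕ} (i j : Fin (n + 1)) :
    inner ℝ (Complex.I • EuclideanSpace.single i 1 : CVec n) (EuclideanSpace.single j 1) =
      (0 : ℝ) := by
  rw [PiLp.inner_apply]
  refine Finset.sum_eq_zero fun b _ => ?_
  by_cases h1 : b = i
  · subst h1
    by_cases h2 : b = j <;> simp [h2]
  · simp [h1]

lemma inner_I_smul_horVec_odd_even {n l m : ℕ} (hl : 1 ≤ l) (hln : l ≤ n) (hm : 1 ≤ m)
    (hmn : m ≤ n) : inner ℝ (Complex.I • horVec n (2 * l - 1)) (horVec n (2 * m)) =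
      if l = m then (1 : ℝ) else 0 := by
  rw [horVec_odd hl hln, horVec_even hm hmn, inner_I_smul_I_smul, inner_single]
  simp

lemma inner_I_smul_horVec_even_odd {n l m : ℕ} (hl : 1 ≤ l) (hln : l ≤ n) (hm : 1 ≤ m)
    (hmn : m ≤ n) : inner ℝ (Complex.I • horVec n (2 * l)) (horVec n (2 * m - 1)) =
      if l = m then (-1 : ℝ) else 0 := by
  rw [inner_I_smul_swap, inner_I_smul_horVec_odd_even hm hmn hl hln]
  by_cases h : l = m <;> simp [h, Ne.symm]

lemma inner_I_smul_horVec_odd_odd {n l m : ℕ} (hl : 1 ≤ l) (hln : l ≤ n) (hm : 1 ≤ m)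
    (hmn : m ≤ n) : inner ℝ (Complex.I • horVec n (2 * l - 1)) (horVec n (2 * m - 1)) =
      (0 : ℝ) := by
  rw [horVec_odd hl hln, horVec_odd hm hmn, inner_I_smul_single]

lemma inner_I_smul_horVec_even_even {n l m : ℕ} (hl : 1 ≤ l) (hln : l ≤ n) (hm : 1 ≤ m)
    (hmn : m ≤ n) : inner ℝ (Complex.I • horVec n (2 * l)) (horVec n (2 * m)) =
      (0 : ℝ) := by
  rw [horVec_even hl hln, horVec_even hm hmn, inner_I_smul_I_smul, inner_I_smul_single]

lemma exists_eq_odd_or_even {n k : ℕ} (h1 : 1 ≤ k) (h2 : k ≤ 2 * n) :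
    ∃ l, 1 ≤ l ∧ l ≤ n ∧ (k = 2 * l - 1 ∨ k = 2 * l) :=
  ⟨(k + 1) / 2, by omega, by omega, by omega⟩

/-- The vectors are `e_l` and `i e_l`, a symplectic basis for `⟨i ·, ·⟩`: each pairs only with its
own partner. -/
lemma exists_of_inner_I_smul_horVec_ne_zero {n j k : ℕ} (hj : 1 ≤ j) (hjn : j ≤ 2 * n)
    (hk : 1 ≤ k) (hkn : k ≤ 2 * n)
    (h : inner ℝ (Complex.I • horVec n j) (horVec n k) ≠ (0 : ℝ)) :
    ∃ l, 1 ≤ l ∧ l ≤ n ∧ ((j = 2 * l - 1 ∧ k = 2 * l) ∨ (j = 2 * l ∧ k = 2 * l - 1)) := by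
  obtain ⟨l, hl, hln, hj'⟩ := exists_eq_odd_or_even hj hjn
  obtain ⟨m, hm, hmn, hk'⟩ := exists_eq_odd_or_even hk hkn
  rcases hj' with rfl | rfl <;> rcases hk' with rfl | rfl
  · exact absurd (inner_I_smul_horVec_odd_odd hl hln hm hmn) h
  · rw [inner_I_smul_horVec_odd_even hl hln hm hmn] at h
    obtain rfl : l = m := by by_contra hne; simp [hne] at h
    exact ⟨l, hl, hln, Or.inl ⟨rfl, rfl⟩⟩
  · rw [inner_I_smul_horVec_even_odd hl hln hm hmn] at h
    obtain rfl : l = m := by by_contra hne; simp [hne] at h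
    exact ⟨l, hl, hln, Or.inr ⟨rfl, rfl⟩⟩
  · exact absurd (inner_I_smul_horVec_even_even hl hln hm hmn) h

lemma hopfCoord_horVec {n k : ℕ} (h1 : 1 ≤ k) (h2 : k ≤ 2 * n) :
    hopfCoord (baseVec n) (horVec n k) = 0 := by
  obtain ⟨l, hl, hln, rfl | rfl⟩ := exists_eq_odd_or_even h1 h2
  · rw [horVec_odd hl hln]
    exact inner_I_smul_single _ _
  · rw [horVec_even hl hln, hopfCoord, inner_I_smul_I_smul, baseVec, inner_single, if_neg]
    simp [Fin.ext_iff]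
    omega

lemma orbitVelocity_fst {n p k : ℕ} (a c : ℝ) (h1 : 1 ≤ k) (h2 : k ≤ 2 * n) :
    orbitVelocity (basisP n p a c k) = (horVec n k, 0) := by
  have : k ≠ 0 := by omega
  simp [orbitVelocity, basisP, this, h2, horVec]

lemma orbitVelocity_snd {n p k : ℕ} (a c : ℝ) (h1 : 2 * n + 2 ≤ k) :
    orbitVelocity (basisP n p a c k) = (0, horVec p (k - (2 * n + 1))) := by
  have e1 : k ≠ 0 := by omega
  have e2 : ¬ k ≤ 2 * n := by omega
  have e3 : k ≠ 2 * n + 1 := by omega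
  simp [orbitVelocity, basisP, e1, e2, e3, horVec]

lemma curvatureComponent_eq {n p : ℕ} {a c : ℝ} (hc : 0 < c) {α ν ρ μ : ℕ}
    (hα : 1 ≤ α) (hαn : α ≤ 2 * n) (hρ : 1 ≤ ρ) (hρn : ρ ≤ 2 * n)
    (hν : 2 * n + 2 ≤ ν) (hνp : ν ≤ 2 * n + 2 * p + 1)
    (hμ : 2 * n + 2 ≤ μ) (hμp : μ ≤ 2 * n + 2 * p + 1) :
    curvatureComponent n p a c α ν ρ μ =
      a / c * inner ℝ (Complex.I • horVec n α) (horVec n ρ)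
        * inner ℝ (Complex.I • horVec p (ν - (2 * n + 1))) (horVec p (μ - (2 * n + 1))) :=
  metric_curvature hc (basePoint n p)
    ((dIncl_frame n p a c α).trans (orbitVelocity_fst a c hα hαn))
    ((dIncl_frame n p a c ρ).trans (orbitVelocity_fst a c hρ hρn))
    ((dIncl_frame n p a c ν).trans (orbitVelocity_snd a c hν))
    ((dIncl_frame n p a c μ).trans (orbitVelocity_snd a c hμ))
    (hopfCoord_horVec hα hαn) (hopfCoord_horVec (by omega) (by omega))
    (hopfCoord_horVec (by omega) (by omega))

end Frame

end HermitianSpheres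

end

/-! ### Evaluation of the components. -/

theorem proposition5 (n p : ℕ) (a c : ℝ) (hc : 0 < c) :
    (∀ l m : ℕ, 1 ≤ l → l ≤ n → 1 ≤ m → m ≤ p →
      HermitianSpheres.curvatureComponent n p a c
          (2 * l - 1) (2 * n + 2 * m) (2 * l) (2 * n + 2 * m + 1) = a / c ∧
      HermitianSpheres.curvatureComponent n p a c
          (2 * l) (2 * n + 2 * m) (2 * l - 1) (2 * n + 2 * m + 1) = -(a / c) ∧
      HermitianSpheres.curvatureComponent n p a c
          (2 * l - 1) (2 * n + 2 * m + 1) (2 * l) (2 * n + 2 * m) = -(a / c) ∧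
      HermitianSpheres.curvatureComponent n p a c
          (2 * l) (2 * n + 2 * m + 1) (2 * l - 1) (2 * n + 2 * m) = a / c) ∧
    (∀ α ν ρ μ : ℕ,
      1 ≤ α → α ≤ 2 * n → 1 ≤ ρ → ρ ≤ 2 * n →
      2 * n + 2 ≤ ν → ν ≤ 2 * n + 2 * p + 1 → 2 * n + 2 ≤ μ → μ ≤ 2 * n + 2 * p + 1 →
      (¬ ∃ l m : ℕ, 1 ≤ l ∧ l ≤ n ∧ 1 ≤ m ∧ m ≤ p ∧
        ((α = 2 * l - 1 ∧ ν = 2 * n + 2 * m ∧ ρ = 2 * l ∧ μ = 2 * n + 2 * m + 1) ∨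
          (α = 2 * l ∧ ν = 2 * n + 2 * m ∧ ρ = 2 * l - 1 ∧ μ = 2 * n + 2 * m + 1) ∨
          (α = 2 * l - 1 ∧ ν = 2 * n + 2 * m + 1 ∧ ρ = 2 * l ∧ μ = 2 * n + 2 * m) ∨
          (α = 2 * l ∧ ν = 2 * n + 2 * m + 1 ∧ ρ = 2 * l - 1 ∧ μ = 2 * n + 2 * m))) →
      HermitianSpheres.curvatureComponent n p a c α ν ρ μ = 0) := by
  open HermitianSpheres in
  refine ⟨fun l m hl hln hm hmp => ?_, fun α ν ρ μ hα hαn hρ hρn hν hνp hμ hμp hne => ?_⟩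
  -- The shift by `2n + 1` reverses parity: the even index `2n + 2m` carries `Y^2_{2m-1}`, the odd
  -- index `2n + 2m + 1` carries `Y^2_{2m}`.
  · have e1 : 2 * n + 2 * m - (2 * n + 1) = 2 * m - 1 := by omega
    have e2 : 2 * n + 2 * m + 1 - (2 * n + 1) = 2 * m := by omega
    refine ⟨?_, ?_, ?_, ?_⟩ <;>
      rw [curvatureComponent_eq hc (by omega) (by omega) (by omega) (by omega) (by omega)
        (by omega) (by omega) (by omega), e1, e2] <;>
      simp only [inner_I_smul_horVec_odd_even hl hln hl hln,
        inner_I_smul_horVec_even_odd hl hln hl hln, inner_I_smul_horVec_odd_even hm hmp hm hmp,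
        inner_I_smul_horVec_even_odd hm hmp hm hmp, if_true] <;>
      ring
  · rw [curvatureComponent_eq hc hα hαn hρ hρn hν hνp hμ hμp]
    -- A nonzero component makes both pairings nonzero, so each index pair is a symplectic pair; the
    -- two orders in each give the four excluded families.
    by_contra h
    have h1 := right_ne_zero_of_mul (left_ne_zero_of_mul h)
    have h2 := right_ne_zero_of_mul h
    obtain ⟨l, hl, hln, h3⟩ := exists_of_inner_I_smul_horVec_ne_zero hα hαn hρ hρn h1
    obtain ⟨m, hm, hmp, h4⟩ := exists_of_inner_I_smul_horVec_ne_zero (by omega) (by omega)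
      (by omega) (by omega) h2
    refine hne ⟨l, m, hl, hln, hm, hmp, ?_⟩
    rcases h3 with ⟨hα', hρ'⟩ | ⟨hα', hρ'⟩ <;> rcases h4 with ⟨hν', hμ'⟩ | ⟨hν', hμ'⟩
    · exact Or.inl ⟨hα', by omega, hρ', by omega⟩
    · exact Or.inr (Or.inr (Or.inl ⟨hα', by omega, hρ', by omega⟩))
    · exact Or.inr (Or.inl ⟨hα', by omega, hρ', by omega⟩)
    · exact Or.inr (Or.inr (Or.inr ⟨hα', by omega, hρ', by omega⟩))
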